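/- For $n\ge 0$, an inversion sequence of length $n$ is an integer sequence $(e_1,\dots,e_n)$ with $0\le e_i\le i-1$ for all $1\le i\le n$. It avoids a word $P=p_1\cdots p_k$ if no subword $e_{i_1}\cdots e_{i_k}$ with $i_1<\cdots<i_k$ is order isomorphic to $P$. Let ${\bf I}_n(P,Q)$ be the set of inversion sequences of length $n$ that avoid both $P$ and $Q$. A weighted ordered tree is an ordered (plane) rooted tree in which each interior vertex (neither the root nor a leaf) is weighted by a positive integer less than or equal to its outdegree (number of children), and no other vertex is weighted. There is a unique formal power series $A(t)\in\mathbb{Q}[[t]]$ with $$A(t)=1+\frac{tA(t)}{1-tA(t)^2},$$ and its coefficients are nonnegative integers: $A(t)=\sum_{n\ge0}a_nt^n$ with $a_n\in\mathbb{N}$ (the sequence A106228 of the OEIS). For every $n\ge 0$, the $(101,021)$-avoiding inversion sequences of length $n$ and the weighted ordered trees with $n$ edges are both counted by $a_n$. Moreover, $|{\bf I}_n(101,102)|=a_n$ as well, so that $$|{\bf I}_n(101,021)|=|{\bf I}_n(101,102)|=a_n\qquad\text{for all } n\ge 0.$$ -/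

import Mathlib

/-- `W` contains the pattern `P`: some subword of `W`, at increasing positions, is order
isomorphic to `P`. -/
def ContainsPattern {n k : ℕ} (W : Fin n → ℕ) (P : Fin k → ℕ) : Prop :=
  ∃ f : Fin k → Fin n, StrictMono f ∧ ∀ a b : Fin k, W (f a) < W (f b) ↔ P a < P b

/-- Inversion sequences of length `n`. Positions are indexed from `0`, so the restriction
`0 ≤ e_i ≤ i - 1` for `1 ≤ i ≤ n` reads `e i ≤ i` for `0 ≤ i < n`. -/
def inversionSequences (n : ℕ) : Set (Fin n → ℕ) :=
  {e | ∀ i : Fin n, e i ≤ (i : ℕ)}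

/-- Inversion sequences of length `n` avoiding both patterns `P` and `Q`. -/
def avoidingInversionSequences (n : ℕ) {k l : ℕ} (P : Fin k → ℕ) (Q : Fin l → ℕ) :
    Set (Fin n → ℕ) :=
  {e ∈ inversionSequences n | ¬ ContainsPattern e P ∧ ¬ ContainsPattern e Q}

/-- Ordered (plane) rooted trees in which every vertex carries an optional weight: a vertex is
given by its weight (`none` if it is unweighted) and the ordered list of the subtrees at its
children. -/
inductive VertexWeightedTree : Type
  | node (weight : Option ℕ) (children : List VertexWeightedTree) : VertexWeightedTree

namespace VertexWeightedTree

/-- The number of edges: each child contributes the edge to it and the edges below it. -/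
def numEdges : VertexWeightedTree → ℕ
  | node _ cs => (cs.attach.map fun c => numEdges c.1 + 1).sum
termination_by t => sizeOf t
decreasing_by
  have := List.sizeOf_lt_of_mem c.2
  simp only [node.sizeOf_spec]
  omega

/-- The weights on a subtree hanging from a child of some vertex are admissible: leaves are
unweighted, and every vertex with at least one child is weighted by a positive integer less than
or equal to its outdegree. -/
inductive IsAdmissibleSubtree : VertexWeightedTree → Prop
  | leaf : IsAdmissibleSubtree (node none [])
  | interior (w : ℕ) (cs : List VertexWeightedTree) (hcs : cs ≠ []) (hw : 1 ≤ w)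
      (hw' : w ≤ cs.length) (h : ∀ c ∈ cs, IsAdmissibleSubtree c) :
      IsAdmissibleSubtree (node (some w) cs)

/-- Weighted ordered trees: exactly the interior vertices (neither the root nor a leaf) are
weighted, each by a positive integer less than or equal to its outdegree. -/
def IsWeightedOrderedTree : VertexWeightedTree → Prop
  | node w cs => w = none ∧ ∀ c ∈ cs, IsAdmissibleSubtree c

end VertexWeightedTree

/-- The weighted ordered trees with `n` edges. -/
def weightedOrderedTrees (n : ℕ) : Set VertexWeightedTree :=
  {T | T.IsWeightedOrderedTree ∧ T.numEdges = n}

/-! Let `L` and `f` be the generating functions of forests and of admissible subtrees. Splitting off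
the first tree of a forest gives `L = 1 + tLf` and, with weights taken into account, `f + L = 1 +
L²`. Eliminating `f` yields `L = 1 + t(L - L² + L³)`, which is the equation for `A` cleared of its
denominator and has only one solution. A weighted ordered tree is a forest below an unweighted root,
so `L` counts these trees.

Inversion sequences are read from left to right, and their completions are counted according to a
state. For `(101, 021)` the state is the length minus the maximum, `d`, and whether the last letter
is `0` or a positive maximum; the completions have series `L f^d` and `L² f^d` respectively, because
these products satisfy the same recursions.

For `(101, 102)` the state contains a stack of earlier letters not yet followed by a smaller one.
The series factors over the gaps of the stack, with a factor `V_g` (`gapSeries`) for a gap `g` and,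
as long as the sequence is weakly increasing, one further factor `N_d` (`slackSeries`). The kernel
method, applied to the recursions of `V` and `N`, gives `N_0 = L`. -/

/-! ### The kernel method -/

open PowerSeries in
/-- Evaluating the power series in `z` over `ℤ⟦t⟧` at a series without constant term. -/
theorem exists_ringHom_eval (Z : PowerSeries ℤ) (hZ : constantCoeff Z = 0) :
    ∃ ev : PowerSeries (PowerSeries ℤ) →+* PowerSeries ℤ, ev X = Z ∧ ∀ r, ev (C r) = r := by
  let _ : UniformSpace ℤ := ⊥
  open scoped PowerSeries.WithPiTopology in
  have h : HasEval Z :=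
    PowerSeries.WithPiTopology.isTopologicallyNilpotent_of_constantCoeff_zero hZ
  have hφ : Continuous (RingHom.id (PowerSeries ℤ)) := continuous_id
  exact ⟨eval₂Hom hφ h, by rw [coe_eval₂Hom, eval₂_X],
    fun r => by rw [coe_eval₂Hom, eval₂_C, RingHom.id_apply]⟩

/-- The kernel method: `N 0` is determined by the convolution recursions for `V` and `N`. -/
theorem kernel_method (A f : PowerSeries ℤ) (hA : A = 1 + PowerSeries.X * A * f)
    (hf : f + A = 1 + A ^ 2) (V N : ℕ → PowerSeries ℤ)
    (hV : ∀ g, V g = 1 + PowerSeries.X * ∑ y ∈ Finset.range g, V y * V (g - y))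
    (hN : ∀ d, N d = 1 + PowerSeries.X * ∑ g ∈ Finset.range (d + 1), V g * N (d + 1 - g)) :
    N 0 = A := by
  set t : PowerSeries ℤ := PowerSeries.X with ht
  -- The value `z = t f` is the root of the kernel `z - t Ψ(z)`, since it will turn out that `Ψ(t f)
  -- = f`.
  obtain ⟨ev, evX, evC⟩ := exists_ringHom_eval (t * f) (by simp [ht])
  set z : PowerSeries (PowerSeries ℤ) := PowerSeries.X with hz
  set Ψ := PowerSeries.mk V
  set Ν := PowerSeries.mk N
  set G : PowerSeries (PowerSeries ℤ) := PowerSeries.mk 1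
  have hG : G * (1 - z) = 1 := PowerSeries.mk_one_mul_one_sub_eq_one _
  have hV0 : V 0 = 1 := by simpa using hV 0
  -- The recursion for `V g` lacks the term `y = g` of the full convolution, namely `V g * V 0 = V
  -- g`; hence the extra `t Ψ` on the left.
  have hΨ : Ψ + PowerSeries.C t * Ψ = G + PowerSeries.C t * (Ψ * Ψ) := by
    ext1 g
    simp only [map_add, PowerSeries.coeff_C_mul]
    rw [PowerSeries.coeff_mul]
    simp only [Ψ, G, PowerSeries.coeff_mk, Pi.one_apply]
    rw [Finset.Nat.sum_antidiagonal_eq_sum_range_succ (fun i j => V i * V j),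
      Finset.sum_range_succ, Nat.sub_self, hV0, mul_one, mul_add, ← add_assoc, ← hV g]
  -- Kernel form: `(z - t Ψ) Ν = z G - t Ψ N 0`. The term with `N 0` is the one that the recursion
  -- for `N d` leaves out of the full convolution.
  have hΝ : z * Ν + PowerSeries.C t * Ψ * PowerSeries.C (N 0)
      = z * G + PowerSeries.C t * (Ψ * Ν) := by
    ext1 d
    cases d with
    | zero => simp [hz, Ψ, Ν, hV0]
    | succ d =>
      rw [mul_assoc]
      simp only [map_add, PowerSeries.coeff_C_mul, PowerSeries.coeff_mul_C, hz,
        PowerSeries.coeff_succ_X_mul]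
      rw [PowerSeries.coeff_mul]
      simp only [Ψ, Ν, G, PowerSeries.coeff_mk, Pi.one_apply]
      rw [Finset.Nat.sum_antidiagonal_eq_sum_range_succ (fun i j => V i * N j),
        Finset.sum_range_succ, Nat.sub_self, mul_add, ← add_assoc, ← hN d]
  have hf0 : PowerSeries.constantCoeff A = 1 := by
    rw [hA]; simp [ht]
  have hfc : PowerSeries.constantCoeff f = 1 := by
    have := congrArg PowerSeries.constantCoeff hf
    simp [hf0] at this
    linarith
  have hz0 : t * f ≠ 0 := by
    refine mul_ne_zero PowerSeries.X_ne_zero fun h => ?_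
    simp [h] at hfc
  have eG : ev G = A := by
    have h1 : ev G * (1 - t * f) = 1 := by
      have := congrArg ev hG
      simpa [evX] using this
    have h2 : A * (1 - t * f) = 1 := by linear_combination hA
    calc ev G = ev G * (A * (1 - t * f)) := by rw [h2, mul_one]
      _ = A * (ev G * (1 - t * f)) := by ring
      _ = A := by rw [h1, mul_one]
  have eΨ : ev Ψ = f := by
    have h1 : ev Ψ + t * ev Ψ = A + t * (ev Ψ * ev Ψ) := by
      have := congrArg ev hΨ
      simpa [evC, eG] using this
    -- `ev Ψ` and `f` solve the same quadratic equation, and the cofactor of their difference has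
    -- constant term `1`.
    have h2 : (ev Ψ - f) * (1 + t - t * (ev Ψ + f)) = 0 := by
      linear_combination h1 + (1 - A) * hA + (t * f - 1) * hf
    rcases mul_eq_zero.1 h2 with h | h
    · exact sub_eq_zero.1 h
    · have := congrArg PowerSeries.constantCoeff h
      simp [ht] at this
  -- At the root of the kernel the terms with `ev Ν` cancel, leaving `t f * N 0 = t f * A`.
  have h3 : t * f * ev Ν + t * f * N 0 = t * f * A + t * (f * ev Ν) := by
    have := congrArg ev hΝ
    simpa [evC, evX, eG, eΨ] using this
  refine mul_left_cancel₀ hz0 ?_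
  linear_combination h3

/-! ### Generating functions of weighted ordered trees -/

section

open Finset.HasAntidiagonal

/-- Turns a unique decomposition into two pieces of total size `n` into a product of generating
functions. -/
theorem encard_biUnion_image_prod {α β γ : Type*} {f : α × β → γ} (hf : f.Injective)
    {s : ℕ → Set α} (hs : ∀ i j x, x ∈ s i → x ∈ s j → i = j) (t : ℕ → Set β) (n : ℕ) :
    (⋃ p ∈ antidiagonal n, f '' (s p.1 ×ˢ t p.2)).encard
      = ∑ p ∈ antidiagonal n, (s p.1).encard * (t p.2).encard := by
  have h := (antidiagonal n).finite_toSet.encard_biUnion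
    (s := fun p => f '' (s p.1 ×ˢ t p.2)) (by
      intro p hp q hq hpq
      refine Set.disjoint_left.2 ?_
      rintro _ ⟨x, hx, rfl⟩ ⟨y, hy, hxy⟩
      obtain rfl := hf hxy
      have := hs _ _ _ hx.1 hy.1
      simp only [SetLike.mem_coe, mem_antidiagonal] at hp hq
      exact hpq (Prod.ext this (by omega)))
  rw [finsum_mem_coe_finset] at h
  simpa only [SetLike.mem_coe, hf.encard_image, Set.encard_prod] using h

namespace VertexWeightedTree

theorem numEdges_node (w : Option ℕ) (cs : List VertexWeightedTree) :
    (node w cs).numEdges = (cs.map fun c => c.numEdges + 1).sum := by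
  rw [numEdges]
  exact congrArg List.sum (List.attach_map_val (l := cs) (f := fun c => c.numEdges + 1))

/-- The admissible subtrees with `n` edges. -/
def admissibleSubtrees (n : ℕ) : Set VertexWeightedTree :=
  {c | c.IsAdmissibleSubtree ∧ c.numEdges = n}

/-- The lists of admissible subtrees which, hung from a common vertex, have `n` edges. -/
def forests (n : ℕ) : Set (List VertexWeightedTree) :=
  {cs | (∀ c ∈ cs, c.IsAdmissibleSubtree) ∧ (cs.map fun c => c.numEdges + 1).sum = n}

/-- The forests with a weight between `1` and the number of their trees. -/
def weightedForests (n : ℕ) : Set (ℕ × List VertexWeightedTree) :=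
  {p | p.2 ∈ forests n ∧ 1 ≤ p.1 ∧ p.1 ≤ p.2.length}

theorem forests_zero : forests 0 = {[]} := by
  ext cs
  cases cs <;> simp [forests]

theorem forests_succ (n : ℕ) : forests (n + 1) = ⋃ p ∈ antidiagonal n,
    (fun q : VertexWeightedTree × List VertexWeightedTree => q.1 :: q.2) ''
      (admissibleSubtrees p.1 ×ˢ forests p.2) := by
  ext cs
  simp only [Set.mem_iUnion, Set.mem_image, Set.mem_prod, Prod.exists, exists_prop,
    mem_antidiagonal]
  constructor
  · intro h
    cases cs with
    | nil => simp [forests] at h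
    | cons c cs =>
      simp only [forests, Set.mem_ofPred_eq, List.mem_cons, forall_eq_or_imp, List.map_cons,
        List.sum_cons] at h
      exact ⟨_, _, by omega, c, cs, ⟨⟨h.1.1, rfl⟩, h.1.2, rfl⟩, rfl⟩
  · rintro ⟨i, j, hij, c, cs, ⟨⟨h1, h2⟩, h3, h4⟩, rfl⟩
    simp only [forests, Set.mem_ofPred_eq, List.mem_cons, forall_eq_or_imp, List.map_cons,
        List.sum_cons]
    exact ⟨⟨h1, h3⟩, by omega⟩

theorem weightedForests_zero : weightedForests 0 = ∅ := by
  ext ⟨w, cs⟩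
  simp only [weightedForests, forests_zero, Set.mem_ofPred_eq, Set.mem_singleton_iff,
    Set.mem_empty_iff_false, iff_false]
  rintro ⟨rfl, h⟩
  simp at h
  omega

/-- A weight above `1` can be lowered by one while the first tree is removed, which keeps it between
`1` and the number of remaining trees. -/
theorem weightedForests_succ (n : ℕ) :
    weightedForests (n + 1) = (fun cs => (1, cs)) '' forests (n + 1) ∪
      ⋃ p ∈ antidiagonal n,
        (fun q : VertexWeightedTree × (ℕ × List VertexWeightedTree) =>
          (q.2.1 + 1, q.1 :: q.2.2)) '' (admissibleSubtrees p.1 ×ˢ weightedForests p.2) := by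
  ext ⟨w, cs⟩
  simp only [Set.mem_union, Set.mem_iUnion, Set.mem_image, Set.mem_prod, Prod.exists,
    exists_prop, mem_antidiagonal, Prod.mk.injEq]
  constructor
  · rintro ⟨h, h1, h2⟩
    dsimp only at h h1 h2
    by_cases hw : w = 1
    · exact Or.inl ⟨cs, h, hw.symm, rfl⟩
    · rw [forests_succ] at h
      simp only [Set.mem_iUnion, Set.mem_image, Set.mem_prod, Prod.exists, exists_prop,
        mem_antidiagonal] at h
      obtain ⟨i, j, hij, c, cs, ⟨hc, hcs⟩, rfl⟩ := h
      refine Or.inr ⟨i, j, hij, c, w - 1, cs, ⟨hc, hcs, ?_, ?_⟩, ?_, rfl⟩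
      · dsimp only; omega
      · simp only [List.length_cons] at h2; dsimp only; omega
      · omega
  · rintro (⟨cs, h, rfl, rfl⟩ | ⟨i, j, hij, c, w, cs, ⟨hc, hcs, h1, h2⟩, rfl, rfl⟩)
    · refine ⟨h, le_rfl, List.length_pos_iff.2 ?_⟩
      rintro rfl
      simp [forests] at h
    · refine ⟨?_, by simp, by simpa using h2⟩
      rw [forests_succ]
      simp only [Set.mem_iUnion, Set.mem_image, Set.mem_prod, Prod.exists, exists_prop,
        mem_antidiagonal]
      exact ⟨i, j, hij, c, cs, ⟨hc, hcs⟩, rfl⟩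

theorem admissibleSubtrees_eq (n : ℕ) : admissibleSubtrees n =
    {c | n = 0 ∧ c = node none []} ∪
      (fun p : ℕ × List VertexWeightedTree => node (some p.1) p.2) '' weightedForests n := by
  ext c
  constructor
  · rintro ⟨h, hn⟩
    cases h with
    | leaf => exact Or.inl ⟨by rw [← hn, numEdges_node]; rfl, rfl⟩
    | interior w cs hcs hw hw' h =>
      exact Or.inr ⟨(w, cs), ⟨⟨h, by rw [← hn, numEdges_node]⟩, hw, hw'⟩, rfl⟩
  · rintro (⟨rfl, rfl⟩ | ⟨⟨w, cs⟩, ⟨⟨h, hn⟩, hw, hw'⟩, rfl⟩)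
    · exact ⟨.leaf, by rw [numEdges_node]; rfl⟩
    · refine ⟨.interior w cs ?_ hw hw' h, by rw [numEdges_node]; exact hn⟩
      rintro rfl
      simp at hw'
      omega

theorem weightedOrderedTrees_eq (n : ℕ) :
    weightedOrderedTrees n = node none '' forests n := by
  ext ⟨w, cs⟩
  simp only [weightedOrderedTrees, Set.mem_ofPred_eq, IsWeightedOrderedTree, numEdges_node,
    forests, Set.mem_image, node.injEq]
  constructor
  · rintro ⟨⟨rfl, h⟩, hn⟩
    exact ⟨cs, ⟨h, hn⟩, rfl, rfl⟩
  · rintro ⟨_, ⟨h, hn⟩, rfl, rfl⟩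
    exact ⟨⟨rfl, h⟩, hn⟩

theorem finite_forests_and_subtrees (n : ℕ) :
    (forests n).Finite ∧ (weightedForests n).Finite ∧ (admissibleSubtrees n).Finite := by
  induction n using Nat.strong_induction_on with
  | _ n ih =>
    have hF : (forests n).Finite := by
      cases n with
      | zero => rw [forests_zero]; exact Set.finite_singleton _
      | succ n =>
        rw [forests_succ]
        refine Set.Finite.biUnion (Finset.finite_toSet _) fun p hp => ?_
        rw [SetLike.mem_coe, mem_antidiagonal] at hp
        exact ((ih p.1 (by omega)).2.2.prod (ih p.2 (by omega)).1).image _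
    have hM : (weightedForests n).Finite := by
      cases n with
      | zero => rw [weightedForests_zero]; exact Set.finite_empty
      | succ n =>
        rw [weightedForests_succ]
        refine (hF.image _).union (Set.Finite.biUnion (Finset.finite_toSet _) fun p hp => ?_)
        rw [SetLike.mem_coe, mem_antidiagonal] at hp
        exact ((ih p.1 (by omega)).2.2.prod (ih p.2 (by omega)).2.1).image _
    refine ⟨hF, hM, ?_⟩
    rw [admissibleSubtrees_eq]
    exact ((Set.finite_singleton (node none [])).subset fun c hc => hc.2).union (hM.image _)

/-- The generating function of the admissible subtrees. -/
noncomputable def subtreeSeries : PowerSeries ℕ :=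
  .mk fun n => (admissibleSubtrees n).ncard

/-- The generating function of the forests. -/
noncomputable def forestSeries : PowerSeries ℕ :=
  .mk fun n => (forests n).ncard

/-- The generating function of the weighted forests. -/
noncomputable def weightedForestSeries : PowerSeries ℕ :=
  .mk fun n => (weightedForests n).ncard

theorem encard_admissibleSubtrees (n : ℕ) :
    (admissibleSubtrees n).encard = ((PowerSeries.coeff n subtreeSeries : ℕ) : ℕ∞) := by
  rw [subtreeSeries, PowerSeries.coeff_mk,
    (finite_forests_and_subtrees n).2.2.cast_ncard_eq]

theorem encard_forests (n : ℕ) :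
    (forests n).encard = ((PowerSeries.coeff n forestSeries : ℕ) : ℕ∞) := by
  rw [forestSeries, PowerSeries.coeff_mk, (finite_forests_and_subtrees n).1.cast_ncard_eq]

theorem encard_weightedForests (n : ℕ) :
    (weightedForests n).encard = ((PowerSeries.coeff n weightedForestSeries : ℕ) : ℕ∞) := by
  rw [weightedForestSeries, PowerSeries.coeff_mk,
    (finite_forests_and_subtrees n).2.1.cast_ncard_eq]

theorem admissibleSubtrees_disjoint (i j : ℕ) (c : VertexWeightedTree)
    (hi : c ∈ admissibleSubtrees i) (hj : c ∈ admissibleSubtrees j) : i = j :=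
  hi.2.symm.trans hj.2

open PowerSeries

theorem forestSeries_eq : forestSeries = 1 + X * (subtreeSeries * forestSeries) := by
  ext n
  apply Nat.cast_injective (R := ℕ∞)
  rw [← encard_forests]
  cases n with
  | zero => simp [forests_zero]
  | succ n =>
    rw [map_add, coeff_succ_X_mul, coeff_mul, forests_succ, encard_biUnion_image_prod _ admissibleSubtrees_disjoint]
    · simp [coeff_one, encard_admissibleSubtrees, encard_forests]
    · rintro ⟨a, b⟩ ⟨c, d⟩ h
      simpa using h

theorem weightedForestSeries_eq :
    weightedForestSeries + 1 = forestSeries + X * (subtreeSeries * weightedForestSeries) := by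
  ext n
  apply Nat.cast_injective (R := ℕ∞)
  rw [map_add, map_add, Nat.cast_add, Nat.cast_add, ← encard_forests, ← encard_weightedForests]
  cases n with
  | zero => simp [forests_zero, weightedForests_zero]
  | succ n =>
    rw [coeff_succ_X_mul, coeff_mul, weightedForests_succ, Set.encard_union_eq,
      encard_biUnion_image_prod _ admissibleSubtrees_disjoint,
      (Prod.mk_right_injective 1).encard_image]
    · simp [coeff_one, encard_admissibleSubtrees,
        encard_weightedForests]
    · rintro ⟨a, b, c⟩ ⟨d, e, f⟩ h
      simp only [Prod.mk.injEq, List.cons.injEq, Nat.add_right_cancel_iff] at h ⊢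
      tauto
    · refine Set.disjoint_left.2 ?_
      rintro _ ⟨cs, -, rfl⟩ h
      simp only [Set.mem_iUnion, Set.mem_image, Set.mem_prod, Prod.exists, exists_prop,
        Prod.mk.injEq] at h
      obtain ⟨i, j, -, c, w, cs, ⟨-, -, h1, -⟩, h2, -⟩ := h
      dsimp only at h1
      omega

theorem subtreeSeries_eq : subtreeSeries = 1 + weightedForestSeries := by
  ext n
  apply Nat.cast_injective (R := ℕ∞)
  rw [map_add, Nat.cast_add, ← encard_admissibleSubtrees, ← encard_weightedForests,
    admissibleSubtrees_eq, Set.encard_union_eq, Function.Injective.encard_image]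
  · cases n <;> simp [coeff_one]
  · rintro ⟨a, b⟩ ⟨c, d⟩ h
    simpa using h
  · refine Set.disjoint_left.2 ?_
    rintro _ ⟨-, rfl⟩ ⟨p, -, h⟩
    simp at h

theorem forestSeries_eq' : forestSeries = 1 + X * forestSeries * subtreeSeries := by
  rw [mul_assoc, mul_comm forestSeries]
  exact forestSeries_eq

/-- Since `L = 1/(1 - Xf)`, the weighted forests have series `L(L - 1)`, and `f` is one more than
that. -/
theorem subtreeSeries_add_forestSeries : subtreeSeries + forestSeries = 1 + forestSeries ^ 2 := by
  apply map_injective (Nat.castRingHom ℤ) Nat.cast_injective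
  have h1 := congrArg (map (Nat.castRingHom ℤ)) forestSeries_eq
  have h2 := congrArg (map (Nat.castRingHom ℤ)) weightedForestSeries_eq
  have h3 := congrArg (map (Nat.castRingHom ℤ)) subtreeSeries_eq
  simp only [map_add, map_mul, map_pow, map_one, map_X] at h1 h2 h3 ⊢
  set L := map (Nat.castRingHom ℤ) forestSeries
  set f := map (Nat.castRingHom ℤ) subtreeSeries
  set M := map (Nat.castRingHom ℤ) weightedForestSeries
  have key : (1 - X * f) * (f + L - (1 + L ^ 2)) = 0 := by
    linear_combination (1 - X * f) * h3 + h2 + (1 - L) * h1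
  rcases mul_eq_zero.1 key with h | h
  · have := congrArg PowerSeries.constantCoeff h
    simp at this
  · exact sub_eq_zero.1 h

end VertexWeightedTree

end

/-! ### Counting words by their first letter -/

/-- The number of words of length `r` with the property `P`. -/
noncomputable def wordCount (P : List ℕ → Prop) (r : ℕ) : ℕ∞ :=
  {w : List ℕ | w.length = r ∧ P w}.encard

theorem wordCount_congr {P Q : List ℕ → Prop} (h : ∀ w, P w ↔ Q w) (r : ℕ) :
    wordCount P r = wordCount Q r := by
  rw [funext fun w => propext (h w)]

theorem wordCount_zero {P : List ℕ → Prop} (h : P []) : wordCount P 0 = 1 := by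
  have : {w : List ℕ | w.length = 0 ∧ P w} = {[]} := by
    ext w
    simp only [Set.mem_ofPred_eq, List.length_eq_zero_iff, Set.mem_singleton_iff]
    exact ⟨fun h => h.1, fun h' => ⟨h', h' ▸ h⟩⟩
  rw [wordCount, this, Set.encard_singleton]

theorem wordCount_succ {P : List ℕ → Prop} {s : Finset ℕ} (h : ∀ x w, P (x :: w) → x ∈ s)
    (r : ℕ) : wordCount P (r + 1) = ∑ x ∈ s, wordCount (fun w => P (x :: w)) r := by
  have hU : {w : List ℕ | w.length = r + 1 ∧ P w}
      = ⋃ x ∈ s, List.cons x '' {w | w.length = r ∧ P (x :: w)} := by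
    ext w
    cases w with
    | nil => simp
    | cons x w =>
      simp only [Set.mem_ofPred_eq, List.length_cons, Nat.add_right_cancel_iff, Set.mem_iUnion,
        Set.mem_image, List.cons.injEq, exists_prop]
      exact ⟨fun hw => ⟨x, h x w hw.2, w, hw, rfl, rfl⟩,
        by rintro ⟨_, -, _, hw, rfl, rfl⟩; exact hw⟩
  have hd := s.finite_toSet.encard_biUnion
    (s := fun x => List.cons x '' {w | w.length = r ∧ P (x :: w)}) (by
      intro x _ y _ hxy
      refine Set.disjoint_left.2 ?_
      rintro _ ⟨w, -, rfl⟩ ⟨v, -, hv⟩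
      exact hxy (List.cons.inj hv).1.symm)
  rw [finsum_mem_coe_finset] at hd
  simpa only [wordCount, hU, SetLike.mem_coe, List.cons_injective.encard_image] using hd

/-- `Restricted o w`: the letters of `w` are admissible in an inversion sequence at the positions
`o, o + 1, …`. -/
def Restricted : ℕ → List ℕ → Prop
  | _, [] => True
  | o, x :: w => x ≤ o ∧ Restricted (o + 1) w

theorem restricted_ofFn {n : ℕ} (o : ℕ) (e : Fin n → ℕ) :
    Restricted o (List.ofFn e) ↔ ∀ i : Fin n, e i ≤ o + i := by
  induction n generalizing o with
  | zero => simp [Restricted]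
  | succ n ih =>
    rw [List.ofFn_succ, Restricted, ih, Fin.forall_fin_succ]
    simp [add_assoc, add_comm 1]

theorem restricted_of_forall_le {o : ℕ} {w : List ℕ} (h : ∀ x ∈ w, x ≤ o) : Restricted o w := by
  induction w generalizing o with
  | nil => trivial
  | cons x w ih =>
    exact ⟨h x (by simp), ih fun y hy => (h y (by simp [hy])).trans (Nat.le_succ o)⟩

theorem containsPattern_iff_sublist {n : ℕ} (e : Fin n → ℕ) (P : Fin 3 → ℕ) :
    ContainsPattern e P ↔ ∃ g : Fin 3 → ℕ, List.Sublist [g 0, g 1, g 2] (List.ofFn e) ∧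
      ∀ a b, g a < g b ↔ P a < P b := by
  constructor
  · rintro ⟨f, hf, h⟩
    refine ⟨e ∘ f, ?_, h⟩
    rw [List.sublist_iff_exists_fin_orderEmbedding_get_eq]
    refine ⟨(OrderEmbedding.ofStrictMono f hf).trans
      (Fin.castOrderIso (List.length_ofFn (f := e)).symm).toOrderEmbedding, fun i => ?_⟩
    fin_cases i <;> simp
  · rintro ⟨g, hg, h⟩
    rw [List.sublist_iff_exists_fin_orderEmbedding_get_eq] at hg
    obtain ⟨f, hf⟩ := hg
    have hfg : ∀ i : Fin 3, e (Fin.cast (List.length_ofFn (f := e)) (f i)) = g i := by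
      intro i
      have := hf i
      simp only [List.get_eq_getElem, List.getElem_ofFn] at this
      refine this.symm.trans ?_
      fin_cases i <;> rfl
    refine ⟨fun i => Fin.cast (List.length_ofFn (f := e)) (f i), fun a b hab => f.strictMono hab,
      fun a b => ?_⟩
    rw [hfg, hfg, h]

theorem encard_avoidingInversionSequences (n : ℕ) (P Q : Fin 3 → ℕ) (R : List ℕ → Prop)
    (h : ∀ e ∈ inversionSequences n,
      R (List.ofFn e) ↔ ¬ ContainsPattern e P ∧ ¬ ContainsPattern e Q) :
    (avoidingInversionSequences n P Q).encard
      = wordCount (fun w => Restricted 0 w ∧ R w) n := by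
  rw [wordCount, ← (List.ofFn_injective (n := n)).encard_image]
  congr 1
  ext w
  constructor
  · rintro ⟨e, ⟨he, he'⟩, rfl⟩
    refine ⟨List.length_ofFn, ?_, (h e he).2 he'⟩
    rw [restricted_ofFn]
    simpa [inversionSequences] using he
  · rintro ⟨rfl, hw, hR⟩
    refine ⟨w.get, ?_, List.ofFn_get w⟩
    have he : w.get ∈ inversionSequences w.length := by
      rw [← List.ofFn_get w, restricted_ofFn] at hw
      simpa [inversionSequences] using hw
    exact ⟨he, (h _ he).1 (by rwa [List.ofFn_get])⟩

theorem containsPattern_101 {n : ℕ} (e : Fin n → ℕ) : ContainsPattern e ![1, 0, 1] ↔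
    ∃ a b, a < b ∧ List.Sublist [b, a, b] (List.ofFn e) := by
  rw [containsPattern_iff_sublist]
  constructor
  · rintro ⟨g, hg, h⟩
    have h1 := h 1 0
    have h2 := h 0 2
    have h3 := h 2 0
    simp at h1 h2 h3
    exact ⟨g 1, g 0, h1, by rwa [le_antisymm h2 h3] at hg⟩
  · rintro ⟨a, b, hab, h⟩
    refine ⟨![b, a, b], by simpa using h, fun i j => ?_⟩
    fin_cases i <;> fin_cases j <;> simp [hab, hab.le]

theorem containsPattern_021 {n : ℕ} (e : Fin n → ℕ) : ContainsPattern e ![0, 2, 1] ↔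
    ∃ a b c, a < b ∧ b < c ∧ List.Sublist [a, c, b] (List.ofFn e) := by
  rw [containsPattern_iff_sublist]
  constructor
  · rintro ⟨g, hg, h⟩
    have h1 := h 0 2
    have h2 := h 2 1
    simp at h1 h2
    exact ⟨g 0, g 2, g 1, h1, h2, hg⟩
  · rintro ⟨a, b, c, hab, hbc, h⟩
    refine ⟨![a, c, b], by simpa using h, fun i j => ?_⟩
    fin_cases i <;> fin_cases j <;>
      simp [hab, hbc, hab.le, hbc.le, hab.trans hbc, (hab.trans hbc).le]

theorem containsPattern_102 {n : ℕ} (e : Fin n → ℕ) : ContainsPattern e ![1, 0, 2] ↔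
    ∃ a b c, a < b ∧ b < c ∧ List.Sublist [b, a, c] (List.ofFn e) := by
  rw [containsPattern_iff_sublist]
  constructor
  · rintro ⟨g, hg, h⟩
    have h1 := h 1 0
    have h2 := h 0 2
    simp at h1 h2
    exact ⟨g 1, g 0, g 2, h1, h2, hg⟩
  · rintro ⟨a, b, c, hab, hbc, h⟩
    refine ⟨![b, a, c], by simpa using h, fun i j => ?_⟩
    fin_cases i <;> fin_cases j <;>
      simp [hab, hbc, hab.le, hbc.le, hab.trans hbc, (hab.trans hbc).le]

/-! ### The patterns 101 and 021 -/

section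

open PowerSeries VertexWeightedTree

theorem pair_sublist_cons {x y c : ℕ} {w : List ℕ} :
    List.Sublist [x, y] (c :: w) ↔ List.Sublist [x, y] w ∨ x = c ∧ y ∈ w := by
  simp [List.sublist_cons_iff, and_assoc]

theorem triple_sublist_cons {x y z c : ℕ} {w : List ℕ} :
    List.Sublist [x, y, z] (c :: w) ↔ List.Sublist [x, y, z] w ∨ x = c ∧ List.Sublist [y, z] w := by
  simp [List.sublist_cons_iff (l' := w) (a := c), and_assoc]

/-- The positive letters of `w` are weakly increasing, and there is no `0` between equal positive
letters. -/
def IncreasingPositives (w : List ℕ) : Prop :=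
  (∀ x y, List.Sublist [x, y] w → 0 < x → y = 0 ∨ x ≤ y) ∧
    ∀ x, 0 < x → ¬ List.Sublist [x, 0, x] w

theorem increasingPositives_nil : IncreasingPositives [] := by simp [IncreasingPositives]

theorem increasingPositives_zero_cons {w : List ℕ} :
    IncreasingPositives (0 :: w) ↔ IncreasingPositives w := by
  simp only [IncreasingPositives, pair_sublist_cons, triple_sublist_cons]
  grind

theorem increasingPositives_pos_cons {x : ℕ} (hx : 0 < x) {w : List ℕ} :
    IncreasingPositives (x :: w) ↔ IncreasingPositives w ∧ (∀ y ∈ w, y = 0 ∨ x ≤ y) ∧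
      ¬ List.Sublist [0, x] w := by
  simp only [IncreasingPositives, pair_sublist_cons, triple_sublist_cons]
  grind

/-- An inversion sequence starts with `0`, so any descent between positive letters completes a 021.
Without such descents, the middle letter of a 101 can only be `0`. -/
theorem increasingPositives_iff {n : ℕ} {e : Fin n → ℕ} (he : e ∈ inversionSequences n) :
    IncreasingPositives (List.ofFn e) ↔
      ¬ ContainsPattern e ![1, 0, 1] ∧ ¬ ContainsPattern e ![0, 2, 1] := by
  rw [containsPattern_101, containsPattern_021]
  have h0 : List.ofFn e = [] ∨ ∃ w, List.ofFn e = 0 :: w := by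
    cases n with
    | zero => exact Or.inl List.ofFn_zero
    | succ n =>
      refine Or.inr ⟨_, (List.ofFn_succ (f := e)).trans (congrArg (· :: _) ?_)⟩
      exact Nat.le_zero.1 (he 0)
  rcases h0 with h | ⟨w, h⟩ <;> rw [h]
  · simp [IncreasingPositives]
  · rw [increasingPositives_zero_cons]
    simp only [IncreasingPositives, triple_sublist_cons]
    have h2 : ∀ {x y z : ℕ}, List.Sublist [x, y, z] w → List.Sublist [x, y] w ∧
        List.Sublist [y, z] w := fun h =>
      ⟨.trans (by simp) h, .trans (by simp) h⟩
    constructor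
    · rintro ⟨h1, h3⟩
      refine ⟨?_, ?_⟩
      · rintro ⟨a, b, hab, h | h⟩
        · rcases h1 b a (h2 h).1 (by omega) with rfl | h4
          · exact h3 b hab h
          · omega
        · omega
      · rintro ⟨a, b, c, hab, hbc, h⟩
        have h : List.Sublist [c, b] w := h.elim (fun h => (h2 h).2) (fun h => h.2)
        rcases h1 c b h (by omega) with h | h <;> omega
    · rintro ⟨h1, h3⟩
      refine ⟨fun x y hxy hx => ?_, fun x hx h => h1 ⟨0, x, hx, Or.inl h⟩⟩
      by_contra! hc
      exact h3 ⟨0, y, x, by omega, hc.2, Or.inr ⟨rfl, hxy⟩⟩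

/-- The words that complete a `(101, 021)`-avoiding inversion sequence of length `i` with
maximum `m` and last letter `0`. -/
def CompletionAfterZero (i m : ℕ) (w : List ℕ) : Prop :=
  Restricted i w ∧ IncreasingPositives w ∧ ∀ x ∈ w, x = 0 ∨ m < x

/-- The words that complete a `(101, 021)`-avoiding inversion sequence of length `i` with
maximum and last letter `m > 0`. -/
def CompletionAfterMax (i m : ℕ) (w : List ℕ) : Prop :=
  Restricted i w ∧ IncreasingPositives w ∧ (∀ x ∈ w, x = 0 ∨ m ≤ x) ∧ ¬ List.Sublist [0, m] w

theorem completionAfterZero_zero_cons {i m : ℕ} {w : List ℕ} :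
    CompletionAfterZero i m (0 :: w) ↔ CompletionAfterZero (i + 1) m w := by
  simp [CompletionAfterZero, Restricted, increasingPositives_zero_cons]

theorem completionAfterZero_pos_cons {i m x : ℕ} (hx : 0 < x) {w : List ℕ} :
    CompletionAfterZero i m (x :: w) ↔ x ∈ Finset.Ioc m i ∧ CompletionAfterMax (i + 1) x w := by
  simp only [CompletionAfterZero, CompletionAfterMax, Restricted, increasingPositives_pos_cons hx,
    Finset.mem_Ioc, List.forall_mem_cons]
  grind

/-- Once a `0` follows `m`, another `m` would create a 101, so later positive letters must exceed
`m`. -/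
theorem completionAfterMax_zero_cons {i m : ℕ} (hm : 0 < m) {w : List ℕ} :
    CompletionAfterMax i m (0 :: w) ↔ CompletionAfterZero (i + 1) m w := by
  have h : List.Sublist [0, m] w → m ∈ w := fun h => h.subset (by simp)
  simp only [CompletionAfterZero, CompletionAfterMax, Restricted, increasingPositives_zero_cons,
    pair_sublist_cons]
  grind

theorem completionAfterMax_pos_cons {i m x : ℕ} (hm : 0 < m) (hx : 0 < x) {w : List ℕ} :
    CompletionAfterMax i m (x :: w) ↔ x ∈ Finset.Icc m i ∧ CompletionAfterMax (i + 1) x w := by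
  have h : List.Sublist [0, m] w → m ∈ w := fun h => h.subset (by simp)
  simp only [CompletionAfterMax, Restricted, increasingPositives_pos_cons hx,
    pair_sublist_cons, Finset.mem_Icc, List.forall_mem_cons]
  grind

/-- The recursion of the completions after a `0`, for their generating functions. -/
theorem forestSeries_mul_pow_eq (m d : ℕ) :
    forestSeries * subtreeSeries ^ d = 1 + X * (forestSeries * subtreeSeries ^ (d + 1) +
      ∑ x ∈ Finset.Ioc m (m + d), forestSeries ^ 2 * subtreeSeries ^ (m + d + 1 - x)) := by
  have hsum : ∑ x ∈ Finset.Ioc m (m + d), forestSeries ^ 2 * subtreeSeries ^ (m + d + 1 - x)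
      = ∑ c ∈ Finset.range d, forestSeries ^ 2 * subtreeSeries ^ (c + 1) := by
    -- Substitute `c = m + d - x`, so that the sum no longer depends on `m` and grows by one term
    -- with `d`.
    refine Finset.sum_nbij' (fun x => m + d - x) (fun c => m + d - c) ?_ ?_ ?_ ?_ ?_
    all_goals intro x hx
    all_goals simp only [Finset.mem_Ioc, Finset.mem_range] at hx ⊢
    iterate 4 omega
    congr 2
    omega
  rw [hsum]
  clear hsum
  have h1 := forestSeries_eq'
  have h2 := subtreeSeries_add_forestSeries
  generalize forestSeries = A at *
  generalize subtreeSeries = f at *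
  induction d with
  | zero => simpa [mul_assoc] using h1
  | succ d ih =>
    rw [Finset.sum_range_succ]
    set S := ∑ c ∈ Finset.range d, A ^ 2 * f ^ (c + 1)
    apply map_injective (Nat.castRingHom ℤ) Nat.cast_injective
    replace h1 := congrArg (map (Nat.castRingHom ℤ)) h1
    replace h2 := congrArg (map (Nat.castRingHom ℤ)) h2
    replace ih := congrArg (map (Nat.castRingHom ℤ)) ih
    simp only [map_add, map_mul, map_pow, map_one, map_X] at h1 h2 ih ⊢
    generalize map (Nat.castRingHom ℤ) A = A at *
    generalize map (Nat.castRingHom ℤ) f = f at *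
    -- The increments of both sides agree because `f - 1 = L(L - 1) = X L² f` and `f - 1 + L = L²`.
    linear_combination ih + f ^ d * h2 - f ^ d * (1 - f - A) * h1

/-- Apart from the term `x = m`, the right side is the recursion for `L f^d`; what remains is `L = 1
+ XLf` multiplied by `L f^d`. -/
theorem forestSeries_sq_mul_pow_eq (m d : ℕ) :
    forestSeries ^ 2 * subtreeSeries ^ d = 1 + X * (forestSeries * subtreeSeries ^ (d + 1) +
      ∑ x ∈ Finset.Icc m (m + d), forestSeries ^ 2 * subtreeSeries ^ (m + d + 1 - x)) := by
  rw [← Finset.add_sum_Ioc_eq_sum_Icc (by omega), ← add_assoc, add_comm (_ * _ ^ (d + 1)),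
    add_assoc, mul_add, add_left_comm, ← forestSeries_mul_pow_eq]
  have h1 := forestSeries_eq'
  rw [show m + d + 1 - m = d + 1 by omega]
  nth_rewrite 1 [pow_two, h1]
  ring

/-- The counts and the coefficients of the two products obey the same recursion in the first letter.
A letter `x` changes the slack to `m + d + 1 - x`, while a `0` keeps the maximum and raises the
slack to `d + 1`. -/
theorem wordCount_completion (r : ℕ) : ∀ m d,
    wordCount (CompletionAfterZero (m + d) m) r
        = ((coeff r (forestSeries * subtreeSeries ^ d) : ℕ) : ℕ∞) ∧
      (0 < m → wordCount (CompletionAfterMax (m + d) m) r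
        = ((coeff r (forestSeries ^ 2 * subtreeSeries ^ d) : ℕ) : ℕ∞)) := by
  induction r with
  | zero =>
    intro m d
    rw [forestSeries_mul_pow_eq m d, forestSeries_sq_mul_pow_eq m d, wordCount_zero]
    · refine ⟨by simp, fun _ => ?_⟩
      rw [wordCount_zero]
      · simp
      · simp [CompletionAfterMax, Restricted, increasingPositives_nil]
    · simp [CompletionAfterZero, Restricted, increasingPositives_nil]
  | succ r ih =>
    intro m d
    have hZ : wordCount (CompletionAfterZero (m + d + 1) m) r
        = ((coeff r (forestSeries * subtreeSeries ^ (d + 1)) : ℕ) : ℕ∞) := (ih m (d + 1)).1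
    have hM : ∀ x ∈ Finset.Icc m (m + d), 0 < x →
        wordCount (CompletionAfterMax (m + d + 1) x) r
          = ((coeff r (forestSeries ^ 2 * subtreeSeries ^ (m + d + 1 - x)) : ℕ) : ℕ∞) := by
      intro x hx hx0
      rw [Finset.mem_Icc] at hx
      rw [← (ih x (m + d + 1 - x)).2 hx0, show x + (m + d + 1 - x) = m + d + 1 by omega]
    refine ⟨?_, fun hm => ?_⟩
    · rw [forestSeries_mul_pow_eq m d, wordCount_succ (s := insert 0 (Finset.Ioc m (m + d))),
        Finset.sum_insert (by simp), wordCount_congr fun w => completionAfterZero_zero_cons, hZ]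
      · simp only [map_add, coeff_succ_X_mul, coeff_one, map_sum, Nat.cast_add, Nat.cast_sum,
          if_neg (Nat.succ_ne_zero r), zero_add]
        congr 1
        refine Finset.sum_congr rfl fun x hx => ?_
        have hx' := Finset.mem_Ioc.1 hx
        rw [← hM x (Finset.Ioc_subset_Icc_self hx) (by omega)]
        refine wordCount_congr (fun w => ?_) r
        rw [completionAfterZero_pos_cons (by omega), and_iff_right hx]
      · intro x w hw
        rcases Nat.eq_zero_or_pos x with rfl | hx
        · simp
        · exact Finset.mem_insert_of_mem ((completionAfterZero_pos_cons hx).1 hw).1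
    · rw [forestSeries_sq_mul_pow_eq m d, wordCount_succ (s := insert 0 (Finset.Icc m (m + d))),
        Finset.sum_insert (by simp; omega),
        wordCount_congr fun w => completionAfterMax_zero_cons hm, hZ]
      · simp only [map_add, coeff_succ_X_mul, coeff_one, map_sum, Nat.cast_add, Nat.cast_sum,
          if_neg (Nat.succ_ne_zero r), zero_add]
        congr 1
        refine Finset.sum_congr rfl fun x hx => ?_
        have hx' := Finset.mem_Icc.1 hx
        rw [← hM x hx (by omega)]
        refine wordCount_congr (fun w => ?_) r
        rw [completionAfterMax_pos_cons hm (by omega), and_iff_right hx]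
      · intro x w hw
        rcases Nat.eq_zero_or_pos x with rfl | hx
        · simp
        · exact Finset.mem_insert_of_mem ((completionAfterMax_pos_cons hm hx).1 hw).1

theorem encard_avoiding_101_021 (n : ℕ) :
    (avoidingInversionSequences n ![1, 0, 1] ![0, 2, 1]).encard
      = ((coeff n forestSeries : ℕ) : ℕ∞) := by
  rw [encard_avoidingInversionSequences n _ _ IncreasingPositives fun e => increasingPositives_iff]
  have h := (wordCount_completion n 0 0).1
  rw [pow_zero, mul_one] at h
  rw [← h]
  refine wordCount_congr (fun w => ?_) n
  simp [CompletionAfterZero, Nat.eq_zero_or_pos]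

end

/-! ### The patterns 101 and 102 -/

section

/-- No letter is followed by a smaller one and then by one that is at least as large. -/
def AvoidsReturns (w : List ℕ) : Prop :=
  ∀ a b c, List.Sublist [b, a, c] w → a < b → c < b

/-- After a letter smaller than `s`, all letters are smaller than `s`. -/
def StaysBelow (s : ℕ) (w : List ℕ) : Prop :=
  ∀ a c, List.Sublist [a, c] w → a < s → c < s

theorem avoidsReturns_cons {x : ℕ} {w : List ℕ} :
    AvoidsReturns (x :: w) ↔ AvoidsReturns w ∧ StaysBelow x w := by
  simp only [AvoidsReturns, StaysBelow, triple_sublist_cons]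
  grind

theorem staysBelow_cons {s x : ℕ} {w : List ℕ} :
    StaysBelow s (x :: w) ↔ StaysBelow s w ∧ (x < s → ∀ c ∈ w, c < s) := by
  simp only [StaysBelow, pair_sublist_cons]
  grind

theorem staysBelow_of_forall_lt {s : ℕ} {w : List ℕ} (h : ∀ c ∈ w, c < s) : StaysBelow s w :=
  fun _ c hc _ => h c (hc.subset (by simp))

theorem staysBelow_cons_of_le {s x : ℕ} (h : s ≤ x) {w : List ℕ} :
    StaysBelow s (x :: w) ↔ StaysBelow s w := by
  rw [staysBelow_cons, and_iff_left fun h' => absurd h' (by omega)]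

theorem avoidsReturns_iff {n : ℕ} (e : Fin n → ℕ) : AvoidsReturns (List.ofFn e) ↔
    ¬ ContainsPattern e ![1, 0, 1] ∧ ¬ ContainsPattern e ![1, 0, 2] := by
  rw [containsPattern_101, containsPattern_102]
  constructor
  · refine fun h => ⟨?_, ?_⟩
    · rintro ⟨a, b, hab, hs⟩
      exact lt_irrefl _ (h a b b hs hab)
    · rintro ⟨a, b, c, hab, hbc, hs⟩
      exact absurd (h a b c hs hab) (by omega)
  · rintro ⟨h1, h2⟩ a b c hs hab
    by_contra! hbc
    rcases hbc.eq_or_lt with rfl | hbc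
    · exact h1 ⟨a, b, hab, hs⟩
    · exact h2 ⟨a, b, c, hab, hbc, hs⟩

/-- `S` is weakly decreasing from `B` on and ends with `0`. -/
def IsStackBelow : ℕ → List ℕ → Prop
  | B, [] => B = 0
  | B, s :: S => s ≤ B ∧ IsStackBelow s S

theorem IsStackBelow.le {B : ℕ} {S : List ℕ} (h : IsStackBelow B S) : ∀ s ∈ S, s ≤ B := by
  induction S generalizing B with
  | nil => simp
  | cons s S ih =>
    simp only [List.forall_mem_cons]
    exact ⟨h.1, fun s' hs' => (ih h.2 s' hs').trans h.1⟩

/-- The words below the bound `B` that complete a sequence in which the letters of `S` may still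
be followed by larger ones. -/
def BoundedCompletion (B : ℕ) (S : List ℕ) (w : List ℕ) : Prop :=
  (∀ x ∈ w, x < B) ∧ AvoidsReturns w ∧ ∀ s ∈ S, StaysBelow s w

/-- The words that complete a weakly increasing inversion sequence of length `i` with maximum `m`
and smaller letters `S`. -/
def IncreasingCompletion (i m : ℕ) (S : List ℕ) (w : List ℕ) : Prop :=
  Restricted i w ∧ AvoidsReturns w ∧ ∀ s ∈ m :: S, StaysBelow s w

/-- A letter below the top `s` of the stack makes `s` the new bound. The letter is not consumed, so
it can pop several entries in turn. -/
theorem boundedCompletion_cons_of_lt {B s x : ℕ} {S : List ℕ} (hs : s ≤ B) (hx : x < s)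
    {w : List ℕ} : BoundedCompletion B (s :: S) (x :: w) ↔ BoundedCompletion s S (x :: w) := by
  have h := staysBelow_of_forall_lt (s := s) (w := w)
  simp only [BoundedCompletion, List.forall_mem_cons, staysBelow_cons]
  grind

theorem boundedCompletion_cons_of_le {B s x : ℕ} {S : List ℕ} (hS : IsStackBelow s S)
    (hx : x ∈ Finset.Ico s B) {w : List ℕ} :
    BoundedCompletion B (s :: S) (x :: w) ↔ BoundedCompletion B (x :: s :: S) w := by
  rw [Finset.mem_Ico] at hx
  have h : (∀ s' ∈ S, StaysBelow s' (x :: w)) ↔ ∀ s' ∈ S, StaysBelow s' w :=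
    forall₂_congr fun s' hs' => staysBelow_cons_of_le ((hS.le s' hs').trans hx.1)
  simp only [BoundedCompletion, List.forall_mem_cons, staysBelow_cons_of_le hx.1, h,
    avoidsReturns_cons]
  tauto

/-- After the first descent all letters stay below `m ≤ i`, so the position bound holds
automatically and the slack no longer matters. -/
theorem increasingCompletion_cons_of_lt {i m x : ℕ} {S : List ℕ} (hm : m ≤ i) (hx : x < m)
    {w : List ℕ} : IncreasingCompletion i m S (x :: w) ↔ BoundedCompletion m S (x :: w) := by
  have h := staysBelow_of_forall_lt (s := m) (w := w)
  have h' : (∀ c ∈ x :: w, c < m) → Restricted i (x :: w) := fun h =>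
    restricted_of_forall_le fun c hc => (h c hc).le.trans hm
  simp only [BoundedCompletion, IncreasingCompletion, List.forall_mem_cons, staysBelow_cons]
    at h' ⊢
  grind

theorem increasingCompletion_cons_of_le {i m x : ℕ} {S : List ℕ} (hS : IsStackBelow m S)
    (hx : m ≤ x) {w : List ℕ} : IncreasingCompletion i m S (x :: w) ↔
      x ≤ i ∧ IncreasingCompletion (i + 1) x (m :: S) w := by
  have h : (∀ s' ∈ S, StaysBelow s' (x :: w)) ↔ ∀ s' ∈ S, StaysBelow s' w :=
    forall₂_congr fun s' hs' => staysBelow_cons_of_le ((hS.le s' hs').trans hx)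
  simp only [IncreasingCompletion, List.forall_mem_cons, staysBelow_cons_of_le hx, h,
    avoidsReturns_cons, Restricted]
  tauto

open PowerSeries Finset.HasAntidiagonal

/-- The coefficients of `gapSeries`. -/
def gapCount : ℕ → ℕ → ℕ
  | 0, _ => 1
  | r + 1, g => ∑ y ∈ Finset.range g, ∑ p ∈ (antidiagonal r).attach,
      gapCount p.1.1 y * gapCount p.1.2 (g - y)
termination_by r => r
decreasing_by
  all_goals have := mem_antidiagonal.1 p.2; omega

/-- The generating function of the words with letters in `[s, s + g)` that complete a sequence in
which `s` and no larger letter below `s + g` may still be followed by larger ones. -/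
def gapSeries (g : ℕ) : PowerSeries ℕ := .mk fun r => gapCount r g

theorem gapSeries_eq (g : ℕ) :
    gapSeries g = 1 + X * ∑ y ∈ Finset.range g, gapSeries y * gapSeries (g - y) := by
  ext r
  cases r with
  | zero => simp [gapSeries, gapCount]
  | succ r =>
    rw [map_add, coeff_succ_X_mul, map_sum, coeff_one, if_neg (Nat.succ_ne_zero r), zero_add,
      gapSeries, coeff_mk, gapCount]
    refine Finset.sum_congr rfl fun y _ => ?_
    rw [coeff_mul, Finset.sum_attach (antidiagonal r)
      (fun p => gapCount p.1 y * gapCount p.2 (g - y))]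
    simp [gapSeries]

/-- The coefficients of `slackSeries`. -/
def slackCount : ℕ → ℕ → ℕ
  | 0, _ => 1
  | r + 1, d => ∑ g ∈ Finset.range (d + 1), ∑ p ∈ (antidiagonal r).attach,
      gapCount p.1.1 g * slackCount p.1.2 (d + 1 - g)
termination_by r => r
decreasing_by
  have := mem_antidiagonal.1 p.2; omega

/-- The factor of the generating function of the completions of a weakly increasing inversion
sequence that depends on the difference `d` of its length and its maximum. -/
def slackSeries (d : ℕ) : PowerSeries ℕ := .mk fun r => slackCount r d

theorem slackSeries_eq (d : ℕ) : slackSeries d =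
    1 + X * ∑ g ∈ Finset.range (d + 1), gapSeries g * slackSeries (d + 1 - g) := by
  ext r
  cases r with
  | zero => simp [slackSeries, slackCount]
  | succ r =>
    rw [map_add, coeff_succ_X_mul, map_sum, coeff_one, if_neg (Nat.succ_ne_zero r), zero_add,
      slackSeries, coeff_mk, slackCount]
    refine Finset.sum_congr rfl fun g _ => ?_
    rw [coeff_mul, Finset.sum_attach (antidiagonal r)
      (fun p => gapCount p.1 g * slackCount p.2 (d + 1 - g))]
    simp [gapSeries, slackSeries]

/-- The generating function of `BoundedCompletion`. -/
noncomputable def stackSeries : ℕ → List ℕ → PowerSeries ℕ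
  | _, [] => 1
  | B, s :: S => gapSeries (B - s) * stackSeries s S

theorem constantCoeff_stackSeries (B : ℕ) (S : List ℕ) : constantCoeff (stackSeries B S) = 1 := by
  induction S generalizing B with
  | nil => simp [stackSeries]
  | cons s S ih => rw [stackSeries, map_mul, ih, gapSeries_eq]; simp

/-- A first letter `x` in `[s, B)` is pushed and splits the gap `B - s` into `B - x` and `x - s`,
matching the recursion of `gapSeries`. A smaller first letter, or an empty word, is accounted for by
the shorter stack. -/
theorem wordCount_boundedCompletion (r : ℕ) : ∀ B S, IsStackBelow B S →
    wordCount (BoundedCompletion B S) r = ((coeff r (stackSeries B S) : ℕ) : ℕ∞) := by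
  induction r with
  | zero =>
    intro B S _
    rw [coeff_zero_eq_constantCoeff_apply, constantCoeff_stackSeries, wordCount_zero, Nat.cast_one]
    simp [BoundedCompletion, AvoidsReturns, StaysBelow]
  | succ r ih =>
    intro B S hS
    induction S generalizing B with
    | nil =>
      obtain rfl : B = 0 := hS
      rw [wordCount_succ (s := ∅) fun x w h => absurd (h.1 x (by simp)) (Nat.not_lt_zero x)]
      simp [stackSeries, coeff_one]
    | cons s S ihS =>
      -- Popping keeps the length `r + 1`, which is why an inner induction on the stack is needed.
      have hlt : wordCount (BoundedCompletion s S) (r + 1)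
          = ∑ x ∈ Finset.range s, wordCount (fun w => BoundedCompletion B (s :: S) (x :: w)) r := by
        rw [wordCount_succ (s := Finset.range s)
          fun x w h => Finset.mem_range.2 (h.1 x (by simp))]
        exact Finset.sum_congr rfl fun x hx => wordCount_congr
          (fun w => (boundedCompletion_cons_of_lt hS.1 (Finset.mem_range.1 hx)).symm) r
      have hle : ∀ x ∈ Finset.Ico s B, wordCount (fun w => BoundedCompletion B (s :: S) (x :: w)) r
          = ((coeff r (stackSeries B (x :: s :: S)) : ℕ) : ℕ∞) := by
        intro x hx
        rw [wordCount_congr fun w => boundedCompletion_cons_of_le hS.2 hx, ih]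
        rw [Finset.mem_Ico] at hx
        exact ⟨hx.2.le, hx.1, hS.2⟩
      rw [wordCount_succ (s := Finset.range B) fun x w h => Finset.mem_range.2 (h.1 x (by simp)),
        ← Finset.sum_range_add_sum_Ico _ hS.1, ← hlt, ihS s hS.2, Finset.sum_congr rfl hle,
        Finset.sum_Ico_eq_sum_range]
      conv_rhs => rw [stackSeries, gapSeries_eq, add_mul, one_mul, mul_assoc, map_add,
        coeff_succ_X_mul, Finset.sum_mul, map_sum]
      push_cast
      congr 1
      refine Finset.sum_congr rfl fun y _ => ?_
      rw [stackSeries, stackSeries, Nat.add_sub_cancel_left, Nat.sub_add_eq, ← mul_assoc,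
        mul_comm (gapSeries y)]

/-- A first letter `x ≥ m` adds the gap `x - m` to the stack and leaves slack `i + 1 - x`; a smaller
one starts the bounded phase. -/
theorem wordCount_increasingCompletion (r : ℕ) : ∀ i m S, m ≤ i → IsStackBelow m S →
    wordCount (IncreasingCompletion i m S) r
      = ((coeff r (stackSeries m S * slackSeries (i - m)) : ℕ) : ℕ∞) := by
  induction r with
  | zero =>
    intro i m S _ _
    rw [coeff_zero_eq_constantCoeff_apply, map_mul, constantCoeff_stackSeries, slackSeries_eq,
      wordCount_zero]
    · simp
    · simp [IncreasingCompletion, Restricted, AvoidsReturns, StaysBelow]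
  | succ r ih =>
    intro i m S hm hS
    have hlt : wordCount (BoundedCompletion m S) (r + 1)
        = ∑ x ∈ Finset.range m, wordCount (fun w => IncreasingCompletion i m S (x :: w)) r := by
      rw [wordCount_succ (s := Finset.range m)
        fun x w h => Finset.mem_range.2 (h.1 x (by simp))]
      exact Finset.sum_congr rfl fun x hx => wordCount_congr
        (fun w => (increasingCompletion_cons_of_lt hm (Finset.mem_range.1 hx)).symm) r
    have hle : ∀ x ∈ Finset.Ico m (i + 1),
        wordCount (fun w => IncreasingCompletion i m S (x :: w)) r
          = ((coeff r (stackSeries x (m :: S) * slackSeries (i + 1 - x)) : ℕ) : ℕ∞) := by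
      intro x hx
      rw [Finset.mem_Ico] at hx
      rw [← ih (i + 1) x (m :: S) hx.2.le ⟨hx.1, hS⟩]
      refine wordCount_congr (fun w => ?_) r
      rw [increasingCompletion_cons_of_le hS hx.1, and_iff_right (by omega)]
    rw [wordCount_succ (s := Finset.range (i + 1)) fun x w h => Finset.mem_range.2
        (Nat.lt_succ_of_le h.1.1), ← Finset.sum_range_add_sum_Ico _ (hm.trans (Nat.le_succ i)),
      ← hlt, wordCount_boundedCompletion _ _ _ hS, Finset.sum_congr rfl hle,
      Finset.sum_Ico_eq_sum_range]
    conv_rhs => rw [slackSeries_eq, mul_add, mul_one, mul_left_comm, map_add,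
      coeff_succ_X_mul, Finset.mul_sum, map_sum]
    push_cast
    rw [← Nat.sub_add_comm hm]
    congr 1
    refine Finset.sum_congr rfl fun y _ => ?_
    rw [stackSeries, Nat.add_sub_cancel_left, Nat.sub_add_eq, ← mul_assoc,
      mul_comm (gapSeries y)]

theorem slackSeries_zero : slackSeries 0 = VertexWeightedTree.forestSeries := by
  apply map_injective (Nat.castRingHom ℤ) Nat.cast_injective
  have h1 := congrArg (map (Nat.castRingHom ℤ)) VertexWeightedTree.forestSeries_eq'
  have h2 := congrArg (map (Nat.castRingHom ℤ)) VertexWeightedTree.subtreeSeries_add_forestSeries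
  simp only [map_add, map_mul, map_pow, map_one, map_X] at h1 h2
  refine kernel_method _ _ h1 h2 (fun g => map (Nat.castRingHom ℤ) (gapSeries g))
    (fun d => map (Nat.castRingHom ℤ) (slackSeries d)) (fun g => ?_) fun d => ?_
  · simpa only [map_add, map_mul, map_sum, map_one, map_X]
      using congrArg (map (Nat.castRingHom ℤ)) (gapSeries_eq g)
  · simpa only [map_add, map_mul, map_sum, map_one, map_X]
      using congrArg (map (Nat.castRingHom ℤ)) (slackSeries_eq d)

theorem encard_avoiding_101_102 (n : ℕ) :
    (avoidingInversionSequences n ![1, 0, 1] ![1, 0, 2]).encard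
      = ((coeff n VertexWeightedTree.forestSeries : ℕ) : ℕ∞) := by
  rw [encard_avoidingInversionSequences n _ _ AvoidsReturns fun e _ => avoidsReturns_iff e]
  have h := wordCount_increasingCompletion n 0 0 [] le_rfl rfl
  rw [stackSeries, one_mul, Nat.sub_zero, slackSeries_zero] at h
  rw [← h]
  refine wordCount_congr (fun w => ?_) n
  simp [IncreasingCompletion, StaysBelow]

/-! ### The functional equation and the tree count -/

open VertexWeightedTree in
theorem eq_add_mul_inv_iff (A : PowerSeries ℚ) :
    A = 1 + X * A * (1 - X * A ^ 2)⁻¹ ↔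
      A = PowerSeries.mk fun n => ((coeff n forestSeries : ℕ) : ℚ) := by
  have hL : (PowerSeries.mk fun n => ((coeff n forestSeries : ℕ) : ℚ))
      = map (Nat.castRingHom ℚ) forestSeries := by
    ext n
    simp
  rw [hL]
  have h1 := congrArg (map (Nat.castRingHom ℚ)) forestSeries_eq'
  have h2 := congrArg (map (Nat.castRingHom ℚ)) subtreeSeries_add_forestSeries
  simp only [map_add, map_mul, map_pow, map_one, map_X] at h1 h2
  generalize map (Nat.castRingHom ℚ) forestSeries = L at *
  generalize map (Nat.castRingHom ℚ) subtreeSeries = f at *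
  have hinv : ∀ A : PowerSeries ℚ, A = 1 + X * A * (1 - X * A ^ 2)⁻¹ ↔
      A = 1 + X * (A - A ^ 2 + A ^ 3) := by
    intro A
    have hc : constantCoeff (1 - X * A ^ 2) ≠ 0 := by simp
    rw [← sub_eq_iff_eq_add', PowerSeries.eq_mul_inv_iff_mul_eq hc]
    constructor <;> intro h <;> linear_combination h
  rw [hinv]
  have hL' : L = 1 + X * (L - L ^ 2 + L ^ 3) := by linear_combination h1 + X * L * h2
  refine ⟨fun h => ?_, fun h => h ▸ hL'⟩
  -- The difference of the two cubic equations is divisible by `A - L`, with a cofactor of constant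
  -- term `1`.
  have key : (A - L) * (1 - X * (1 - (A + L) + (A ^ 2 + A * L + L ^ 2))) = 0 := by
    linear_combination h - hL'
  rcases mul_eq_zero.1 key with h | h
  · exact sub_eq_zero.1 h
  · have := congrArg PowerSeries.constantCoeff h
    simp at this

open VertexWeightedTree in
theorem encard_weightedOrderedTrees (n : ℕ) :
    (weightedOrderedTrees n).encard = ((coeff n forestSeries : ℕ) : ℕ∞) := by
  rw [weightedOrderedTrees_eq, Function.Injective.encard_image, encard_forests]
  intro a b h
  simpa using h

end

theorem mainTheorem6 :
    ∃ a : ℕ → ℕ,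
      (∀ A : PowerSeries ℚ,
        A = 1 + PowerSeries.X * A * (1 - PowerSeries.X * A ^ 2)⁻¹ ↔
          A = PowerSeries.mk fun n => (a n : ℚ)) ∧
      (∀ n : ℕ, (avoidingInversionSequences n ![1, 0, 1] ![0, 2, 1]).encard = (a n : ℕ∞)) ∧
      (∀ n : ℕ, (weightedOrderedTrees n).encard = (a n : ℕ∞)) ∧
      (∀ n : ℕ, (avoidingInversionSequences n ![1, 0, 1] ![1, 0, 2]).encard = (a n : ℕ∞)) ∧
      (∀ n : ℕ, (avoidingInversionSequences n ![1, 0, 1] ![0, 2, 1]).encard =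
        (avoidingInversionSequences n ![1, 0, 1] ![1, 0, 2]).encard) := by
  exact ⟨fun n => PowerSeries.coeff n VertexWeightedTree.forestSeries, eq_add_mul_inv_iff,
    encard_avoiding_101_021, encard_weightedOrderedTrees, encard_avoiding_101_102,
    fun n => (encard_avoiding_101_021 n).trans (encard_avoiding_101_102 n).symm⟩
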